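/- Let $A$ be an alphabet (a nonempty finite set). A finite poset labeled by $A$ is considered up to label-preserving order isomorphism; $P\parallel P'$ is the disjoint union of $P$ and $P'$ with elements of $P$ incomparable to those of $P'$, and $P\cdot P'$ is the disjoint union in which, in addition, every element of $P$ is below every element of $P'$. $SP(A)$ is the smallest class of $A$-labeled posets that contains the posets with at most one element and is closed under $\parallel$ and $\cdot$, and $SP^+(A)$ is the class of nonempty posets in $SP(A)$. A branching automaton over $A$ consists of a finite set $Q$ of states, sets $I,F\subseteq Q$ of initial and final states, a set $E_{\mathrm{seq}}\subseteq Q\times A\times Q$, and finite sets $E_{\mathrm{fork}}\subseteq Q\times\mathcal M^{>1}(Q)$ and $E_{\mathrm{join}}\subseteq\mathcal M^{>1}(Q)\times Q$, where $\mathcal M^{>1}(Q)$ is the set of multisets over $Q$ with at least two elements. The relation "there is a path from $p$ to $q$ labeled by $P\in SP^+(A)$" is the smallest one such that: 1. if $(p,a,q)\in E_{\mathrm{seq}}$, there is a path from $p$ to $q$ labeled by the one-element poset $a$; 2. if $k\ge 1$, there are paths from $r_j$ to $s_j$ labeled by $P_j$ for $0\le j\le k$, $(p,\{r_0,\dots,r_k\})\in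 E_{\mathrm{fork}}$ and $(\{s_0,\dots,s_k\},q)\in E_{\mathrm{join}}$ (multisets), then there is a path from $p$ to $q$ labeled by $P_0\parallel\cdots\parallel P_k$; 3. if there are paths from $p$ to $r$ labeled by $P$ and from $r$ to $q$ labeled by $P'$, then there is a path from $p$ to $q$ labeled by $P\cdot P'$. A P-branching automaton over $A$ is defined in the same way, except that $E_{\mathrm{fork}}$ and $E_{\mathrm{join}}$ are finite sets of pairs $(p,\varphi)$ with $p\in Q$ and $\varphi$ a Presburger formula (a first-order formula over $(\mathbb N,+)$) with one free variable for each state of $Q$, and that in rule 2 the conditions on the fork and the join are replaced by: there are $(p,\varphi)\in E_{\mathrm{fork}}$ and $(q,\varphi')\in E_{\mathrm{join}}$ such that $\varphi$ holds at the Parikh image of the multiset $\{r_0,\dots,r_k\}$ and $\varphi'$ holds at the Parikh image of the multiset $\{s_0,\dots,s_k\}$; the Parikh image of a multiset over $Q$ is its vector of multiplicities in $\mathbb N^Q$. The language of an automaton of either kind is the set of all $P\in SP^+(A)$ that label a path from an initial state to a final state. A language $L\subseteq SP^+(A)$ is regular if it is the language of a branching automaton, and P-regular if it is the language of a P-branching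 automaton. Theorem. For every alphabet $A$ and every language $L\subseteq SP^+(A)$, $L$ is regular if and only if it is P-regular. -/

import Mathlib

universe u

/-- A finite poset labeled by `A`. -/
structure LPoset (A : Type u) where
  carrier : Type
  [order : PartialOrder carrier]
  [finite : Finite carrier]
  label : carrier → A

namespace LPoset

variable {A : Type u}

attribute [instance] LPoset.order LPoset.finite

/-- The empty labeled poset. -/
def empty : LPoset A where
  carrier := Empty
  label := Empty.elim

/-- The one-element poset labeled by the letter `a`. -/
def single (a : A) : LPoset A where
  carrier := Unit
  label := fun _ => a

/-- Parallel product: elements of `P` and of `Q` are incomparable. -/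
def par (P Q : LPoset A) : LPoset A where
  carrier := P.carrier ⊕ Q.carrier
  label := Sum.elim P.label Q.label

/-- Sequential product: every element of `P` is below every element of `Q`. -/
def seq (P Q : LPoset A) : LPoset A where
  carrier := P.carrier ⊕ₗ Q.carrier
  finite := inferInstanceAs (Finite (P.carrier ⊕ Q.carrier))
  label := fun x => Sum.elim P.label Q.label (ofLex x)

/-- Isomorphism of labeled posets: an order isomorphism that preserves labels. -/
def Iso (P Q : LPoset A) : Prop :=
  ∃ e : P.carrier ≃o Q.carrier, ∀ x, Q.label (e x) = P.label x

instance setoid (A : Type u) : Setoid (LPoset A) where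
  r := Iso
  iseqv :=
    { refl := fun P => ⟨OrderIso.refl _, fun _ => rfl⟩
      symm := by
        rintro P Q ⟨e, he⟩
        exact ⟨e.symm, fun x => by rw [← he, OrderIso.apply_symm_apply]⟩
      trans := by
        rintro P Q R ⟨e, he⟩ ⟨f, hf⟩
        exact ⟨e.trans f, fun x => by rw [OrderIso.trans_apply, hf, he]⟩ }

theorem par_congr {P P' Q Q' : LPoset A} (h : P ≈ P') (h' : Q ≈ Q') : P.par Q ≈ P'.par Q' := by
  obtain ⟨e, he⟩ := h
  obtain ⟨f, hf⟩ := h'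
  exact ⟨OrderIso.sumCongr e f, Sum.rec he hf⟩

theorem seq_congr {P P' Q Q' : LPoset A} (h : P ≈ P') (h' : Q ≈ Q') : P.seq Q ≈ P'.seq Q' := by
  obtain ⟨e, he⟩ := h
  obtain ⟨f, hf⟩ := h'
  exact ⟨OrderIso.sumLexCongr e f, Sum.rec he hf⟩

end LPoset

/-- Finite posets labeled by `A`, up to isomorphism. -/
def LPosetClass (A : Type u) : Type (max 1 u) := Quotient (LPoset.setoid A)

namespace LPosetClass

variable {A : Type u}

/-- The empty poset. -/
def ε : LPosetClass A := Quotient.mk _ LPoset.empty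

/-- The letter `a`, as a one-element labeled poset. -/
def letter (a : A) : LPosetClass A := Quotient.mk _ (LPoset.single a)

/-- The parallel product of isomorphism classes. -/
def par : LPosetClass A → LPosetClass A → LPosetClass A :=
  Quotient.map₂ LPoset.par fun _ _ h _ _ h' => LPoset.par_congr h h'

/-- The sequential product of isomorphism classes. -/
def seq : LPosetClass A → LPosetClass A → LPosetClass A :=
  Quotient.map₂ LPoset.seq fun _ _ h _ _ h' => LPoset.seq_congr h h'

/-- `SP(A)`: the smallest class containing the labeled posets with zero and one element and
closed under parallel and sequential product. -/
inductive IsSP : LPosetClass A → Prop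
  | empty : IsSP ε
  | letter (a : A) : IsSP (letter a)
  | par {P Q : LPosetClass A} : IsSP P → IsSP Q → IsSP (par P Q)
  | seq {P Q : LPosetClass A} : IsSP P → IsSP Q → IsSP (seq P Q)

theorem mk_eq_ε_iff (P : LPoset A) :
    (Quotient.mk _ P : LPosetClass A) = ε ↔ IsEmpty P.carrier := by
  constructor
  · intro h
    obtain ⟨e, -⟩ := Quotient.exact h
    exact e.toEquiv.isEmpty_congr.2 (inferInstanceAs (IsEmpty Empty))
  · intro h
    refine Quotient.sound ⟨⟨Equiv.equivOfIsEmpty _ Empty, fun {a} => isEmptyElim a⟩, fun a => ?_⟩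
    exact isEmptyElim a

theorem letter_ne_ε (a : A) : letter a ≠ ε := by
  exact fun h => ((mk_eq_ε_iff (LPoset.single a)).1 h).elim ()

theorem par_ne_ε {P Q : LPosetClass A} (hP : P ≠ ε) : par P Q ≠ ε := by
  induction P using Quotient.inductionOn
  induction Q using Quotient.inductionOn
  intro h
  exact hP ((mk_eq_ε_iff _).2 ⟨fun x => ((mk_eq_ε_iff _).1 h).elim (Sum.inl x)⟩)

theorem seq_ne_ε {P Q : LPosetClass A} (hP : P ≠ ε) : seq P Q ≠ ε := by
  induction P using Quotient.inductionOn
  induction Q using Quotient.inductionOn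
  intro h
  exact hP ((mk_eq_ε_iff _).2 ⟨fun x => ((mk_eq_ε_iff _).1 h).elim (toLex (Sum.inl x))⟩)

end LPosetClass

/-- `SP⁺(A)`: the nonempty series-parallel posets labeled by `A`, up to isomorphism. -/
def SPPlus (A : Type u) : Type (max 1 u) :=
  {P : LPosetClass A // P.IsSP ∧ P ≠ LPosetClass.ε}

namespace SPPlus

variable {A : Type u}

/-- The letter `a`. -/
def letter (a : A) : SPPlus A :=
  ⟨LPosetClass.letter a, .letter a, LPosetClass.letter_ne_ε a⟩

/-- The parallel product on `SP⁺(A)`. -/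
def par (P Q : SPPlus A) : SPPlus A :=
  ⟨P.1.par Q.1, .par P.2.1 Q.2.1, LPosetClass.par_ne_ε P.2.2⟩

/-- The sequential product on `SP⁺(A)`. -/
def seq (P Q : SPPlus A) : SPPlus A :=
  ⟨P.1.seq Q.1, .seq P.2.1 Q.2.1, LPosetClass.seq_ne_ε P.2.2⟩

/-- The parallel product `P₀ ∥ ⋯ ∥ Pₖ` of a finite nonempty sequence. -/
def bigPar : {k : ℕ} → (Fin (k + 1) → SPPlus A) → SPPlus A
  | 0, P => P 0
  | _ + 1, P => (P 0).par (bigPar fun j => P j.succ)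

end SPPlus

/-- The multiset of values of a finite sequence of states. -/
def stateMultiset {Q : Type} {n : ℕ} (r : Fin n → Q) : Multiset Q :=
  Finset.univ.val.map r

/-- Labels of paths, where `seq` are the sequential transitions, `fork p R` says that some fork
transition leads from `p` to the multiset `R` of branch states, and `join R q` says that some join
transition leads from the multiset `R` of branch states to `q`.
`HasPath seq fork join p P q` means that there is a path from `p` to `q` labeled by `P`.
Products of longer sequences of consecutive paths are obtained by iterating `comp`. -/
inductive HasPath {A : Type u} {Q : Type} (seq : Set (Q × A × Q))
    (fork : Q → Multiset Q → Prop) (join : Multiset Q → Q → Prop) : Q → SPPlus A → Q → Prop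
  | letter {p : Q} {a : A} {q : Q} : (p, a, q) ∈ seq →
      HasPath seq fork join p (SPPlus.letter a) q
  | branch {k : ℕ} (hk : 1 ≤ k) {r s : Fin (k + 1) → Q} {P : Fin (k + 1) → SPPlus A} {p q : Q} :
      (∀ j, HasPath seq fork join (r j) (P j) (s j)) →
      fork p (stateMultiset r) → join (stateMultiset s) q →
      HasPath seq fork join p (SPPlus.bigPar P) q
  | comp {p r q : Q} {P P' : SPPlus A} :
      HasPath seq fork join p P r → HasPath seq fork join r P' q →
      HasPath seq fork join p (P.seq P') q

/-- `𝓜^{>1}(Q)`: the multisets over `Q` with at least two elements. -/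
abbrev BranchMultiset (Q : Type) : Type := {R : Multiset Q // 1 < R.card}

/-- A branching automaton with set of states `Q` over the alphabet `A`. It has finitely many
transitions. -/
structure BranchingAutomaton (Q : Type) (A : Type u) where
  seq : Set (Q × A × Q)
  fork : Set (Q × BranchMultiset Q)
  join : Set (BranchMultiset Q × Q)
  init : Set Q
  final : Set Q
  seq_finite : seq.Finite
  fork_finite : fork.Finite
  join_finite : join.Finite

namespace BranchingAutomaton

variable {Q : Type} {A : Type u} (𝒜 : BranchingAutomaton Q A)

/-- There is a path from `p` to `q` labeled by `P`. -/
def HasPath (p : Q) (P : SPPlus A) (q : Q) : Prop :=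
  _root_.HasPath 𝒜.seq (fun p R => ∃ t ∈ 𝒜.fork, t.1 = p ∧ t.2.1 = R)
    (fun R q => ∃ t ∈ 𝒜.join, t.1.1 = R ∧ t.2 = q) p P q

/-- The set of labels of paths from an initial state to a final state. -/
def language : Set (SPPlus A) :=
  {P | ∃ i ∈ 𝒜.init, ∃ f ∈ 𝒜.final, 𝒜.HasPath i P f}

end BranchingAutomaton

open Classical in
/-- The Parikh image of a multiset of states: the number of occurrences of each state. -/
noncomputable def parikh {Q : Type} (R : Multiset Q) : Q → ℕ := fun q => R.count q

/-- Presburger formulas with one free variable for each state in `Q`. -/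
abbrev Pres (Q : Type) : Type := FirstOrder.Language.presburger.Formula Q

/-- The Presburger set of a formula: the tuples of natural numbers that make it true. -/
def presburgerSet {Q : Type} (φ : Pres Q) : Set (Q → ℕ) := {v | φ.Realize v}

/-- A P-branching automaton with set of states `Q` over the alphabet `A`. It has finitely many
transitions. -/
structure PBranchingAutomaton (Q : Type) (A : Type u) where
  seq : Set (Q × A × Q)
  fork : Set (Q × Pres Q)
  join : Set (Q × Pres Q)
  init : Set Q
  final : Set Q
  seq_finite : seq.Finite
  fork_finite : fork.Finite
  join_finite : join.Finite

namespace PBranchingAutomaton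

variable {Q : Type} {A : Type u} (𝒜 : PBranchingAutomaton Q A)

/-- There is a path from `p` to `q` labeled by `P`. -/
def HasPath (p : Q) (P : SPPlus A) (q : Q) : Prop :=
  _root_.HasPath 𝒜.seq (fun p R => ∃ t ∈ 𝒜.fork, t.1 = p ∧ parikh R ∈ presburgerSet t.2)
    (fun R q => ∃ t ∈ 𝒜.join, t.1 = q ∧ parikh R ∈ presburgerSet t.2) p P q

/-- The set of labels of paths from an initial state to a final state. -/
def language : Set (SPPlus A) :=
  {P | ∃ i ∈ 𝒜.init, ∃ f ∈ 𝒜.final, 𝒜.HasPath i P f}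

end PBranchingAutomaton

/-- A language is regular if it is the language of a branching automaton. -/
def IsRegularLanguage {A : Type u} (L : Set (SPPlus A)) : Prop :=
  ∃ (Q : Type) (_ : Finite Q) (𝒜 : BranchingAutomaton Q A), L = 𝒜.language

/-- A language is P-regular if it is the language of a P-branching automaton. -/
def IsPRegularLanguage {A : Type u} (L : Set (SPPlus A)) : Prop :=
  ∃ (Q : Type) (_ : Finite Q) (𝒜 : PBranchingAutomaton Q A), L = 𝒜.language

/-! From regular to P-regular: each multiset in a transition is replaced by a Presburger formula
whose only solution is its Parikh image.

Conversely, a branching step is recorded as a block, the multiset of pairs (start, end) of its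
branches (`hasPath_iff_blockPath`). The fork and join conditions depend only on the two projections
of this multiset, which are additive. Hence, for given outer states, the admissible blocks form a
semilinear subset of `Multiset (Q × Q)`: a finite union of linear sets, each a base plus all sums of
periods. Two simulations remain.

A linear set is generated by finitely many blocks: an extra branch enters a loop that splits off
periods, and since the parallel product is associative, nested loops flatten (`blockPath_loop_iff`).

Finitely many blocks are realized by ordinary forks and joins, although these do not see which start
is matched with which end. Each state gets a tag naming its block and branch; paths preserve tags,
so the join recovers the block. The tags of the surrounding state must survive the block. Two
registers suffice: each branch holds its own tag and one inherited tag, and a block has at least two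
branches (`hasPath_tagged_iff`). -/

/-! ### The commutative monoid of labeled posets under parallel product -/

namespace LPosetClass

variable {A : Type u}

theorem par_comm (P Q : LPosetClass A) : par P Q = par Q P := by
  induction P using Quotient.inductionOn
  induction Q using Quotient.inductionOn
  exact Quotient.sound ⟨OrderIso.sumComm _ _, Sum.rec (fun _ => rfl) fun _ => rfl⟩

theorem par_assoc (P Q R : LPosetClass A) : par (par P Q) R = par P (par Q R) := by
  induction P using Quotient.inductionOn
  induction Q using Quotient.inductionOn
  induction R using Quotient.inductionOn
  exact Quotient.sound ⟨OrderIso.sumAssoc _ _ _,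
    Sum.rec (Sum.rec (fun _ => rfl) fun _ => rfl) fun _ => rfl⟩

theorem ε_par (P : LPosetClass A) : par ε P = P := by
  induction P using Quotient.inductionOn with
  | h P =>
    refine Quotient.sound (Setoid.symm ⟨⟨(Equiv.emptySum Empty P.carrier).symm, ?_⟩, fun _ => rfl⟩)
    exact Sum.inr_le_inr_iff

/-- Labeled posets form a commutative monoid under parallel product. -/
instance : CommMonoid (LPosetClass A) where
  mul := par
  one := ε
  mul_assoc := par_assoc
  mul_comm := par_comm
  one_mul := ε_par
  mul_one P := (par_comm P ε).trans (ε_par P)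

end LPosetClass

theorem SPPlus.bigPar_val {A : Type u} {k : ℕ} (P : Fin (k + 1) → SPPlus A) :
    (SPPlus.bigPar P).1 = (Finset.univ.val.map fun j => (P j).1).prod := by
  change _ = ∏ j, (P j).1
  induction k with
  | zero => simp [SPPlus.bigPar]
  | succ k ih =>
    rw [Fin.prod_univ_succ, ← ih]
    rfl

/-- The parallel product of a nonempty multiset of elements of `SP⁺(A)` is in `SP⁺(A)`. -/
theorem SPPlus.exists_val_eq_prod {A : Type u} (M : Multiset (SPPlus A)) (hM : M ≠ 0) :
    ∃ P : SPPlus A, P.1 = (M.map fun R => R.1).prod := by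
  induction M using Multiset.induction with
  | empty => exact absurd rfl hM
  | cons a M ih =>
    by_cases h : M = 0
    · exact ⟨a, by rw [h, Multiset.map_cons, Multiset.map_zero, Multiset.prod_cons,
        Multiset.prod_zero, mul_one]⟩
    · obtain ⟨P, hP⟩ := ih h
      exact ⟨a.par P, (congrArg (a.1 * ·) hP).trans (by rw [Multiset.map_cons, Multiset.prod_cons])⟩

/-! ### Lifting enumerations and splittings through `Multiset.map` -/

section Multiset

variable {α β : Type*}

theorem Multiset.exists_fin_of_map_eq (f : α → β) {n : ℕ} {M : Multiset α} {g : Fin n → β}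
    (h : M.map f = Finset.univ.val.map g) :
    ∃ m : Fin n → α, M = Finset.univ.val.map m ∧ ∀ j, f (m j) = g j := by
  classical
  induction n generalizing M with
  | zero => exact ⟨Fin.elim0, by simpa using h, fun j => j.elim0⟩
  | succ n ih =>
    rw [Fin.univ_val_map, List.ofFn_succ, ← Multiset.cons_coe, ← Fin.univ_val_map,
      ← Multiset.map_eq_cons] at h
    obtain ⟨a, ha, hfa, h⟩ := h
    obtain ⟨m, hm, hfm⟩ := ih h
    refine ⟨Fin.cons a m, ?_, Fin.cases hfa hfm⟩
    rw [Fin.univ_val_map, List.ofFn_succ, ← Multiset.cons_coe, ← Fin.univ_val_map]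
    simpa [← hm] using (Multiset.cons_erase ha).symm

theorem Multiset.exists_fin {n : ℕ} {M : Multiset α} (h : M.card = n) :
    ∃ m : Fin n → α, M = Finset.univ.val.map m := by
  have h' : M.map (fun _ => ()) = Finset.univ.val.map fun _ : Fin n => () := by simp [h]
  obtain ⟨m, hm, -⟩ := Multiset.exists_fin_of_map_eq _ h'
  exact ⟨m, hm⟩

theorem Multiset.exists_add_of_map_eq (f : α → β) {M : Multiset α} {s t : Multiset β}
    (h : M.map f = s + t) : ∃ M₁ M₂, M = M₁ + M₂ ∧ M₁.map f = s ∧ M₂.map f = t := by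
  classical
  induction s using Multiset.induction generalizing M with
  | empty => exact ⟨0, M, by simp, rfl, by simpa using h⟩
  | cons b s ih =>
    rw [Multiset.cons_add, ← Multiset.map_eq_cons] at h
    obtain ⟨a, ha, hfa, h⟩ := h
    obtain ⟨M₁, M₂, h₀, h₁, h₂⟩ := ih h
    refine ⟨a ::ₘ M₁, M₂, ?_, by simp [hfa, h₁], h₂⟩
    rw [Multiset.cons_add, ← h₀, Multiset.cons_erase ha]

end Multiset

/-! ### Paths described by blocks -/

/-- Labels of paths, where `B p w q` means that `p` and `q` may be linked by parallel branches
whose pairs of end states form the multiset `w`. -/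
inductive BlockPath {A : Type u} {Q : Type} (seq : Set (Q × A × Q))
    (B : Q → Multiset (Q × Q) → Q → Prop) : Q → SPPlus A → Q → Prop
  | letter {p : Q} {a : A} {q : Q} : (p, a, q) ∈ seq → BlockPath seq B p (SPPlus.letter a) q
  | branch {M : Multiset ((Q × Q) × SPPlus A)} {p q : Q} {P : SPPlus A} :
      (∀ x ∈ M, BlockPath seq B x.1.1 x.2 x.1.2) → 1 < M.card → B p (M.map Prod.fst) q →
      P.1 = (M.map fun x => x.2.1).prod → BlockPath seq B p P q
  | comp {p r q : Q} {P P' : SPPlus A} :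
      BlockPath seq B p P r → BlockPath seq B r P' q → BlockPath seq B p (P.seq P') q

/-- The parallel product is commutative, so the numbering of branches can be forgotten; fork and
join become one condition on the two projections of the multiset of end pairs. -/
theorem hasPath_iff_blockPath {A : Type u} {Q : Type} {seq : Set (Q × A × Q)}
    {fork : Q → Multiset Q → Prop} {join : Multiset Q → Q → Prop} {p q : Q} {P : SPPlus A} :
    HasPath seq fork join p P q ↔
      BlockPath seq (fun p w q => fork p (w.map Prod.fst) ∧ join (w.map Prod.snd) q) p P q := by
  constructor
  · intro h
    induction h with
    | letter h => exact .letter h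
    | comp _ _ ih ih' => exact .comp ih ih'
    | @branch k hk r s P p q _ hf hj ih =>
      refine .branch (M := Finset.univ.val.map fun j => ((r j, s j), P j)) ?_ ?_ ⟨?_, ?_⟩ ?_
      · intro x hx
        obtain ⟨j, -, rfl⟩ := Multiset.mem_map.1 hx
        exact ih j
      · simp only [Multiset.card_map, Finset.card_val, Finset.card_univ, Fintype.card_fin]
        omega
      · rwa [Multiset.map_map, Multiset.map_map]
      · rwa [Multiset.map_map, Multiset.map_map]
      · rw [SPPlus.bigPar_val, Multiset.map_map]; rfl
  · intro h
    induction h with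
    | letter h => exact .letter h
    | comp _ _ ih ih' => exact .comp ih ih'
    | @branch M p q P _ hM hB hP ih =>
      obtain ⟨k, hk⟩ : ∃ k, M.card = k + 1 := ⟨M.card - 1, by omega⟩
      rw [hk] at hM
      obtain ⟨m, hm⟩ := Multiset.exists_fin hk
      subst hm
      have : P = SPPlus.bigPar fun j => (m j).2 := by
        refine Subtype.ext ?_
        rw [SPPlus.bigPar_val, hP, Multiset.map_map]; rfl
      subst this
      refine .branch (by omega) (r := fun j => (m j).1.1) (s := fun j => (m j).1.2)
        (fun j => ih _ (Multiset.mem_map_of_mem _ (Finset.mem_univ j))) ?_ ?_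
      · simp only [Multiset.map_map] at hB
        exact hB.1
      · simp only [Multiset.map_map] at hB
        exact hB.2

/-! ### Finitely many blocks realized by tagged states -/

section Tagged

variable {A : Type u} {Q ι : Type} {n : ι → ℕ}

/-- A tag records a branch of a block, or nothing. -/
abbrev BlockTag (n : ι → ℕ) : Type := Option (Σ i, Fin (n i))

/-- The tag handed over to the `j`-th branch of a block: the first two branches take charge of the
two tags of the state before the block. -/
def carriedTag {T : Type} (τ c : Option T) : ℕ → Option T
  | 0 => τ
  | 1 => c
  | _ => none

/-- The tagged end states of the branches of the block `i`, starting from the end states `r`. -/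
def taggedBranches (i : ι) (r : Fin (n i) → Q) (τ c : BlockTag n) :
    Multiset (Q × BlockTag n × BlockTag n) :=
  Finset.univ.val.map fun j => (r j, some ⟨i, j⟩, carriedTag τ c j)

/-- Sequential transitions that preserve both tags. -/
def taggedSeq (n : ι → ℕ) (seq : Set (Q × A × Q)) :
    Set ((Q × BlockTag n × BlockTag n) × A × (Q × BlockTag n × BlockTag n)) :=
  {t | (t.1.1, t.2.1, t.2.2.1) ∈ seq ∧ t.1.2 = t.2.2.2}

/-- The fork transitions for the blocks with first states `src` and branches `e`. -/
def taggedFork (src : ι → Q) (e : ∀ i, Fin (n i) → Q × Q) (x : Q × BlockTag n × BlockTag n)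
    (R : Multiset (Q × BlockTag n × BlockTag n)) : Prop :=
  ∃ i, src i = x.1 ∧ taggedBranches i (fun j => (e i j).1) x.2.1 x.2.2 = R

/-- The join transitions for the blocks with last states `tgt` and branches `e`. -/
def taggedJoin (tgt : ι → Q) (e : ∀ i, Fin (n i) → Q × Q)
    (R : Multiset (Q × BlockTag n × BlockTag n)) (y : Q × BlockTag n × BlockTag n) : Prop :=
  ∃ i, tgt i = y.1 ∧ taggedBranches i (fun j => (e i j).2) y.2.1 y.2.2 = R

theorem mem_taggedBranches {i : ι} {r : Fin (n i) → Q} {τ c : BlockTag n}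
    {x : Q × BlockTag n × BlockTag n} :
    x ∈ taggedBranches i r τ c ↔ ∃ j, (r j, some ⟨i, j⟩, carriedTag τ c j) = x := by
  simp [taggedBranches]

/-- An own tag names the block and the branch number, so each branch on the left is found again on
the right with the same inherited tag. Branches 0 and 1, which exist by `hn`, give `τ` and `c`. -/
theorem eq_of_map_taggedBranches_eq {i i' : ι} (hn : 2 ≤ n i) {r : Fin (n i) → Q}
    {r' : Fin (n i') → Q} {τ c τ' c' : BlockTag n}
    (h : (taggedBranches i r τ c).map Prod.snd = (taggedBranches i' r' τ' c').map Prod.snd) :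
    i = i' ∧ τ = τ' ∧ c = c' := by
  have key : ∀ j : Fin (n i), i = i' ∧ carriedTag τ c j = carriedTag τ' c' j := by
    intro j
    have hj : (some ⟨i, j⟩, carriedTag τ c j) ∈ (taggedBranches i' r' τ' c').map Prod.snd := by
      rw [← h]
      exact Multiset.mem_map_of_mem Prod.snd (mem_taggedBranches.2 ⟨j, rfl⟩)
    obtain ⟨x, hx, hxj⟩ := Multiset.mem_map.1 hj
    obtain ⟨j', rfl⟩ := mem_taggedBranches.1 hx
    simp only [Prod.mk.injEq, Option.some.injEq] at hxj
    obtain ⟨h₁, h₂⟩ := hxj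
    obtain ⟨rfl, h₁⟩ := Sigma.mk.inj h₁
    obtain rfl := eq_of_heq h₁
    exact ⟨rfl, h₂.symm⟩
  have h₀ := key ⟨0, by omega⟩
  have h₁ := key ⟨1, by omega⟩
  exact ⟨h₀.1, h₀.2, h₁.2⟩

/-- By `hW` the fork and the join see the same tags, so they come from the same block, and the tag
of a branch determines its pair of end states. -/
theorem map_eq_of_taggedBranches {e : ∀ i, Fin (n i) → Q × Q} {i i' : ι} (hn : 2 ≤ n i)
    {τ c τ' c' : BlockTag n}
    {W : Multiset ((Q × BlockTag n × BlockTag n) × (Q × BlockTag n × BlockTag n))}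
    (h₁ : taggedBranches i (fun j => (e i j).1) τ c = W.map Prod.fst)
    (h₂ : taggedBranches i' (fun j => (e i' j).2) τ' c' = W.map Prod.snd)
    (hW : ∀ x ∈ W, x.1.2 = x.2.2) :
    i = i' ∧ τ = τ' ∧ c = c' ∧ W.map (fun x => (x.1.1, x.2.1)) = Finset.univ.val.map (e i) := by
  obtain ⟨rfl, rfl, rfl⟩ : i = i' ∧ τ = τ' ∧ c = c' := by
    refine eq_of_map_taggedBranches_eq hn ?_ (r := fun j => (e i j).1) (r' := fun j => (e i' j).2)
    rw [h₁, h₂, Multiset.map_map, Multiset.map_map]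
    exact Multiset.map_congr rfl hW
  refine ⟨rfl, rfl, rfl, ?_⟩
  -- `f` reads the end pair off the own tag. The value at `none` is irrelevant: the own tag of a
  -- branch is never `none`.
  let f : Q × BlockTag n × BlockTag n → Q × Q := fun x =>
    x.2.1.elim (x.1, x.1) fun t => e t.1 t.2
  have hf : W.map (fun x => (x.1.1, x.2.1)) = (W.map Prod.fst).map f := by
    rw [Multiset.map_map]
    refine Multiset.map_congr rfl fun x hx => ?_
    have hx₁ : x.1 ∈ W.map Prod.fst := Multiset.mem_map_of_mem _ hx
    have hx₂ : x.2 ∈ W.map Prod.snd := Multiset.mem_map_of_mem _ hx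
    rw [← h₁] at hx₁
    rw [← h₂] at hx₂
    obtain ⟨j, hj⟩ := mem_taggedBranches.1 hx₁
    obtain ⟨j', hj'⟩ := mem_taggedBranches.1 hx₂
    have hx := hW x hx
    rw [← hj, ← hj'] at hx
    obtain rfl : j = j' := by simpa using (Prod.mk.inj hx).1
    simp [← hj, ← hj', f]
  rw [hf, ← h₁, taggedBranches, Multiset.map_map]
  rfl

theorem hasPath_tagged_iff {seq : Set (Q × A × Q)} {src tgt : ι → Q}
    {e : ∀ i, Fin (n i) → Q × Q} (hn : ∀ i, 2 ≤ n i) {x y : Q × BlockTag n × BlockTag n}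
    {P : SPPlus A} :
    HasPath (taggedSeq n seq) (taggedFork src e) (taggedJoin tgt e) x P y ↔
      x.2 = y.2 ∧ BlockPath seq
        (fun p w q => ∃ i, src i = p ∧ tgt i = q ∧ Finset.univ.val.map (e i) = w) x.1 P y.1 := by
  rw [hasPath_iff_blockPath]
  constructor
  · intro h
    induction h with
    | letter h => exact ⟨h.2, .letter h.1⟩
    | comp _ _ ih ih' => exact ⟨ih.1.trans ih'.1, .comp ih.2 ih'.2⟩
    | @branch M p q P _ hM hB hP ih =>
      obtain ⟨⟨i, hi, h₁⟩, ⟨i', hi', h₂⟩⟩ := hB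
      obtain ⟨rfl, hτ, hc, hw⟩ := map_eq_of_taggedBranches (hn i) h₁ h₂ (by
        intro x hx
        obtain ⟨y, hy, rfl⟩ := Multiset.mem_map.1 hx
        exact (ih y hy).1)
      refine ⟨Prod.ext hτ hc, .branch (M := M.map fun x => ((x.1.1.1, x.1.2.1), x.2)) ?_ ?_ ?_ ?_⟩
      · intro x hx
        obtain ⟨y, hy, rfl⟩ := Multiset.mem_map.1 hx
        exact (ih y hy).2
      · simpa using hM
      · refine ⟨i, hi, hi', ?_⟩
        rw [← hw, Multiset.map_map, Multiset.map_map]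
        rfl
      · rw [hP, Multiset.map_map]
        rfl
  · obtain ⟨p, t⟩ := x
    obtain ⟨q, t'⟩ := y
    rintro ⟨h, hb⟩
    dsimp only at h hb
    subst h
    -- The tags vary because each branch of a block runs with tags of its own.
    induction hb generalizing t with
    | letter h => exact .letter ⟨h, rfl⟩
    | comp _ _ ih ih' => exact .comp (ih t) (ih' t)
    | @branch M p q P _ hM hB hP ih =>
      obtain ⟨i, rfl, rfl, hw⟩ := hB
      obtain ⟨m, rfl, hm⟩ := Multiset.exists_fin_of_map_eq _ hw.symm
      refine .branch (M := Finset.univ.val.map fun j : Fin (n i) =>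
        ((((e i j).1, some ⟨i, j⟩, carriedTag t.1 t.2 j),
          ((e i j).2, some ⟨i, j⟩, carriedTag t.1 t.2 j)), (m j).2))
        ?_ ?_ ⟨⟨i, rfl, ?_⟩, ⟨i, rfl, ?_⟩⟩ ?_
      · intro x hx
        obtain ⟨j, -, rfl⟩ := Multiset.mem_map.1 hx
        have := ih (m j) (Multiset.mem_map_of_mem _ (Finset.mem_univ j))
        rw [hm] at this
        exact this _
      · simpa using hM
      · simp only [Multiset.map_map]; rfl
      · simp only [Multiset.map_map]; rfl
      · rw [hP]
        simp only [Multiset.map_map]; rfl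

theorem card_taggedBranches (i : ι) (r : Fin (n i) → Q) (τ c : BlockTag n) :
    (taggedBranches i r τ c).card = n i := by
  simp [taggedBranches]

theorem isRegularLanguage_of_blocks [Finite A] [Finite Q] [Finite ι] (seq : Set (Q × A × Q))
    (src tgt : ι → Q) (e : ∀ i, Fin (n i) → Q × Q) (hn : ∀ i, 2 ≤ n i) (I F : Set Q) :
    IsRegularLanguage {P | ∃ p ∈ I, ∃ q ∈ F, BlockPath seq
      (fun p w q => ∃ i, src i = p ∧ tgt i = q ∧ Finset.univ.val.map (e i) = w) p P q} := by
  let fk : ι × BlockTag n × BlockTag n →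
      (Q × BlockTag n × BlockTag n) × BranchMultiset (Q × BlockTag n × BlockTag n) := fun t =>
    ((src t.1, t.2), ⟨taggedBranches t.1 (fun j => (e t.1 j).1) t.2.1 t.2.2, by
      rw [card_taggedBranches]; exact hn _⟩)
  let jn : ι × BlockTag n × BlockTag n →
      BranchMultiset (Q × BlockTag n × BlockTag n) × (Q × BlockTag n × BlockTag n) := fun t =>
    (⟨taggedBranches t.1 (fun j => (e t.1 j).2) t.2.1 t.2.2, by
      rw [card_taggedBranches]; exact hn _⟩, (tgt t.1, t.2))
  refine ⟨Q × BlockTag n × BlockTag n, inferInstance,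
    { seq := taggedSeq n seq
      fork := Set.range fk
      join := Set.range jn
      -- Paths preserve tags, so any fixed pair of outer tags would do; `none` exists even without
      -- blocks.
      init := {x | x.1 ∈ I ∧ x.2 = (none, none)}
      final := {x | x.1 ∈ F ∧ x.2 = (none, none)}
      seq_finite := Set.toFinite _
      fork_finite := Set.finite_range _
      join_finite := Set.finite_range _ }, ?_⟩
  have hfk : (fun x R => ∃ t ∈ Set.range fk, t.1 = x ∧ t.2.1 = R) = taggedFork src e := by
    ext x R
    constructor
    · rintro ⟨_, ⟨t, rfl⟩, rfl, rfl⟩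
      exact ⟨t.1, rfl, rfl⟩
    · rintro ⟨i, hi, rfl⟩
      exact ⟨_, ⟨(i, x.2), rfl⟩, Prod.ext hi rfl, rfl⟩
  have hjn : (fun R x => ∃ t ∈ Set.range jn, t.1.1 = R ∧ t.2 = x) = taggedJoin tgt e := by
    ext R x
    constructor
    · rintro ⟨_, ⟨t, rfl⟩, rfl, rfl⟩
      exact ⟨t.1, rfl, rfl⟩
    · rintro ⟨i, hi, rfl⟩
      exact ⟨_, ⟨(i, x.2), rfl⟩, rfl, Prod.ext hi rfl⟩
  ext P
  simp only [BranchingAutomaton.language, BranchingAutomaton.HasPath, hfk, hjn,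
    hasPath_tagged_iff hn, Set.mem_ofPred_eq]
  constructor
  · rintro ⟨p, hp, q, hq, h⟩
    exact ⟨(p, none, none), ⟨hp, rfl⟩, (q, none, none), ⟨hq, rfl⟩, rfl, h⟩
  · rintro ⟨x, hx, y, hy, -, h⟩
    exact ⟨x.1, hx.1, y.1, hy.1, h⟩

theorem isRegularLanguage_of_finite_blocks [Finite A] [Finite Q] (seq : Set (Q × A × Q))
    {B : Set (Q × Multiset (Q × Q) × Q)} (hB : B.Finite) (hc : ∀ t ∈ B, 1 < t.2.1.card)
    (I F : Set Q) :
    IsRegularLanguage {P | ∃ p ∈ I, ∃ q ∈ F,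
      BlockPath seq (fun p w q => (p, w, q) ∈ B) p P q} := by
  have := hB.to_subtype
  choose e he using fun t : B => Multiset.exists_fin (M := t.1.2.1) rfl
  have hB' : (fun p w q => ∃ t : B, t.1.1 = p ∧ t.1.2.2 = q ∧ Finset.univ.val.map (e t) = w) =
      fun p w q => (p, w, q) ∈ B := by
    ext p w q
    constructor
    · rintro ⟨⟨t, ht⟩, rfl, rfl, rfl⟩
      rw [← he]
      exact ht
    · intro h
      exact ⟨⟨_, h⟩, rfl, rfl, (he _).symm⟩
  rw [← hB']
  exact isRegularLanguage_of_blocks seq (fun t : B => t.1.1) (fun t : B => t.1.2.2) e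
    (fun t => hc t.1 t.2) I F

end Tagged

/-! ### Linear sets of blocks generated by loops -/

section Linear

variable {A : Type u} {Q κ : Type}

/-- The states of `Q` together with, for each index, one state that starts and one state that ends
a loop generating the sums of periods. -/
abbrev LoopState (Q κ : Type) : Type := Q ⊕ κ × Bool

/-- Sequential transitions between the original states. -/
def loopSeq (κ : Type) (seq : Set (Q × A × Q)) : Set (LoopState Q κ × A × LoopState Q κ) :=
  (fun t => (Sum.inl t.1, t.2.1, Sum.inl t.2.2)) '' seq

/-- A multiset of pairs of original states, as pairs of states of the larger set. -/
def liftPairs (κ : Type) (w : Multiset (Q × Q)) : Multiset (LoopState Q κ × LoopState Q κ) :=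
  w.map (Prod.map Sum.inl Sum.inl)

/-- The pair of end states of the loop of index `k`. -/
def loopPair (Q : Type) (k : κ) : LoopState Q κ × LoopState Q κ :=
  (Sum.inr (k, false), Sum.inr (k, true))

/-- The pair of end states of a block: those of the loop, or those of the linear set. -/
def entryPair (src tgt : κ → Q) (k : κ) : Bool → LoopState Q κ × LoopState Q κ
  | false => loopPair Q k
  | true => (Sum.inl (src k), Sum.inl (tgt k))

/-- The base of a block: none for the loop, that of the linear set otherwise. -/
def entryBase (base : κ → Multiset (Q × Q)) (k : κ) : Bool → Multiset (Q × Q)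
  | false => 0
  | true => base k

/-- Finitely many blocks that generate the linear sets with bases `base` and periods `per`. -/
def loopBlocks (src tgt : κ → Q) (base : κ → Multiset (Q × Q))
    (per : κ → Set (Multiset (Q × Q))) :
    Set (LoopState Q κ × Multiset (LoopState Q κ × LoopState Q κ) × LoopState Q κ) :=
  {t | 1 < t.2.1.card ∧ ∃ k z, ∃ u ∈ insert 0 (per k),
    ∃ v ∈ insert {loopPair Q k} (liftPairs κ '' insert 0 (per k)),
      ((entryPair src tgt k z).1, liftPairs κ (entryBase base k z + u) + v,
        (entryPair src tgt k z).2) = t}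

theorem finite_loopBlocks [Finite κ] (src tgt : κ → Q) (base : κ → Multiset (Q × Q))
    {per : κ → Set (Multiset (Q × Q))} (hper : ∀ k, (per k).Finite) :
    (loopBlocks src tgt base per).Finite := by
  refine Set.Finite.subset (s := ⋃ k, ⋃ z, Set.image2 (fun u v =>
    ((entryPair src tgt k z).1, liftPairs κ (entryBase base k z + u) + v,
      (entryPair src tgt k z).2)) (insert 0 (per k))
        (insert {loopPair Q k} (liftPairs κ '' insert 0 (per k)))) ?_ ?_
  · exact Set.finite_iUnion fun k => Set.finite_iUnion fun z =>
      Set.Finite.image2 _ ((hper k).insert _) ((((hper k).insert _).image _).insert _)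
  · rintro t ⟨-, k, z, h⟩
    exact Set.mem_iUnion₂.2 ⟨k, z, h⟩

/-- The multisets of pairs of original states that may replace a pair of states. -/
def Expands (per : κ → Set (Multiset (Q × Q))) :
    LoopState Q κ → LoopState Q κ → Multiset (Q × Q) → Prop
  | Sum.inl p, Sum.inl q, w => w = {(p, q)}
  | Sum.inr (k, false), Sum.inr (k', true), w => k = k' ∧ w ∈ AddSubmonoid.closure (per k)
  | _, _, _ => False

/-- The blocks described by the linear sets with bases `base` and periods `per`. -/
def LinearBlock (src tgt : κ → Q) (base : κ → Multiset (Q × Q))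
    (per : κ → Set (Multiset (Q × Q))) (p : Q) (w : Multiset (Q × Q)) (q : Q) : Prop :=
  ∃ k, src k = p ∧ tgt k = q ∧ ∃ s ∈ AddSubmonoid.closure (per k), base k + s = w

variable {src tgt : κ → Q} {base : κ → Multiset (Q × Q)} {per : κ → Set (Multiset (Q × Q))}

/-- A loop is entered only at `false` and left only at `true`, so two consecutive paths never meet
at a loop state. Sequential composition therefore takes place between original states only. -/
theorem Expands.comp_eq {x y z : LoopState Q κ} {w w' : Multiset (Q × Q)}
    (h : Expands per x y w) (h' : Expands per y z w') :
    ∃ p q r, x = Sum.inl p ∧ y = Sum.inl q ∧ z = Sum.inl r := by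
  rcases x with p | ⟨k, _ | _⟩ <;> rcases y with q | ⟨k', _ | _⟩ <;>
    rcases z with r | ⟨k'', _ | _⟩ <;> simp_all [Expands]

theorem Expands.sum_eq_of_liftPairs {w : Multiset (Q × Q)}
    {N : Multiset ((LoopState Q κ × LoopState Q κ) × Multiset (Q × Q))}
    (hN : ∀ x ∈ N, Expands per x.1.1 x.1.2 x.2) (h : N.map Prod.fst = liftPairs κ w) :
    (N.map Prod.snd).sum = w := by
  induction w using Multiset.induction generalizing N with
  | empty =>
    obtain rfl : N = 0 := by simpa [liftPairs] using h
    rfl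
  | cons a w ih =>
    rw [liftPairs, Multiset.map_cons, ← Multiset.singleton_add] at h
    obtain ⟨N₁, N₂, rfl, h₁, h₂⟩ := Multiset.exists_add_of_map_eq _ h
    obtain ⟨x, rfl, hx⟩ := Multiset.map_eq_singleton.1 h₁
    have hE := hN x (by simp)
    rw [hx] at hE
    have hE : x.2 = {a} := hE
    rw [Multiset.map_add, Multiset.sum_add,
      ih (fun y hy => hN y (Multiset.mem_add.2 (Or.inr hy))) h₂]
    simp [hE]

theorem Expands.sum_mem_of_mem {k : κ} {v : Multiset (LoopState Q κ × LoopState Q κ)}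
    {N : Multiset ((LoopState Q κ × LoopState Q κ) × Multiset (Q × Q))}
    (hN : ∀ x ∈ N, Expands per x.1.1 x.1.2 x.2) (h : N.map Prod.fst = v)
    (hv : v ∈ insert {loopPair Q k} (liftPairs κ '' insert 0 (per k))) :
    (N.map Prod.snd).sum ∈ AddSubmonoid.closure (per k) := by
  rcases hv with rfl | ⟨u, hu, rfl⟩
  · obtain ⟨x, rfl, hx⟩ := Multiset.map_eq_singleton.1 h
    have hE := hN x (by simp)
    rw [hx] at hE
    simpa using hE.2
  · rw [Expands.sum_eq_of_liftPairs hN h]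
    rcases hu with rfl | hu
    · exact zero_mem _
    · exact AddSubmonoid.subset_closure hu

/-- Flattening, by induction on the path: the factors of the branches are collected into one
parallel product. Between loop states this product is kept open, and its end pairs sum to periods;
between original states it is closed into a single path by one linear block. -/
theorem blockPath_of_loop {seq : Set (Q × A × Q)} {x y : LoopState Q κ} {P : SPPlus A}
    (h : BlockPath (loopSeq κ seq) (fun x w y => (x, w, y) ∈ loopBlocks src tgt base per) x P y) :
    ∃ M : Multiset ((Q × Q) × SPPlus A),
      (∀ m ∈ M, BlockPath seq (LinearBlock src tgt base per) m.1.1 m.2 m.1.2) ∧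
        P.1 = (M.map fun m => m.2.1).prod ∧ Expands per x y (M.map Prod.fst) := by
  induction h with
  | letter h =>
    obtain ⟨t, ht, h⟩ := h
    obtain ⟨rfl, rfl, rfl⟩ := by simpa using h
    exact ⟨{((t.1, t.2.2), SPPlus.letter t.2.1)}, by simpa using BlockPath.letter ht,
      (Multiset.prod_singleton _).symm, rfl⟩
  | comp _ _ ih ih' =>
    obtain ⟨M, hM, hP, hE⟩ := ih
    obtain ⟨M', hM', hP', hE'⟩ := ih'
    obtain ⟨p, q, r, rfl, rfl, rfl⟩ := hE.comp_eq hE'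
    obtain ⟨m, rfl, hm⟩ := Multiset.map_eq_singleton.1 hE
    obtain ⟨m', rfl, hm'⟩ := Multiset.map_eq_singleton.1 hE'
    have hb := hM m (Multiset.mem_singleton_self m)
    have hb' := hM' m' (Multiset.mem_singleton_self m')
    rw [hm] at hb
    rw [hm'] at hb'
    rw [Multiset.map_singleton, Multiset.prod_singleton] at hP hP'
    obtain rfl := Subtype.ext hP
    obtain rfl := Subtype.ext hP'
    exact ⟨{((p, r), m.2.seq m'.2)}, by simpa using hb.comp hb',
      (Multiset.prod_singleton _).symm, rfl⟩
  | @branch M' x y P _ hM' hB hP ih =>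
    choose! E hE hEP hEE using ih
    obtain ⟨-, k, z, u, hu, v, hv, ht⟩ := hB
    simp only [Prod.mk.injEq] at ht
    obtain ⟨rfl, hw, rfl⟩ := ht
    have hpath : ∀ m ∈ M'.bind E, BlockPath seq (LinearBlock src tgt base per) m.1.1 m.2 m.1.2 := by
      intro m hm
      obtain ⟨x, hx, hm⟩ := Multiset.mem_bind.1 hm
      exact hE x hx m hm
    have hprod : P.1 = ((M'.bind E).map fun m => m.2.1).prod := by
      rw [hP, Multiset.map_bind, Multiset.prod_bind]
      exact congrArg _ (Multiset.map_congr rfl hEP)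
    obtain ⟨N, hNdef⟩ : ∃ N, N = M'.map fun x => (x.1, (E x).map Prod.fst) := ⟨_, rfl⟩
    have hN : ∀ x ∈ N, Expands per x.1.1 x.1.2 x.2 := by
      intro n hn
      rw [hNdef] at hn
      obtain ⟨x, hx, rfl⟩ := Multiset.mem_map.1 hn
      exact hEE x hx
    have hNfst : N.map Prod.fst = liftPairs κ (entryBase base k z + u) + v := by
      rw [hw, hNdef, Multiset.map_map]
      rfl
    have hNsnd : (N.map Prod.snd).sum = (M'.bind E).map Prod.fst := by
      rw [hNdef, Multiset.map_map, Multiset.map_bind]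
      rfl
    obtain ⟨N₁, N₂, rfl, h₁, h₂⟩ := Multiset.exists_add_of_map_eq _ hNfst
    have hs₁ := Expands.sum_eq_of_liftPairs
      (fun x hx => hN x (Multiset.mem_add.2 (Or.inl hx))) h₁
    have hs₂ := Expands.sum_mem_of_mem
      (fun x hx => hN x (Multiset.mem_add.2 (Or.inr hx))) h₂ hv
    have hs : ∃ s ∈ AddSubmonoid.closure (per k),
        entryBase base k z + s = (M'.bind E).map Prod.fst := by
      refine ⟨u + (N₂.map Prod.snd).sum, add_mem ?_ hs₂, ?_⟩
      · rcases hu with rfl | hu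
        · exact zero_mem _
        · exact AddSubmonoid.subset_closure hu
      · rw [← hNsnd, Multiset.map_add, Multiset.sum_add, hs₁, add_assoc]
    cases z with
    | false =>
      refine ⟨M'.bind E, hpath, hprod, rfl, ?_⟩
      obtain ⟨s, hs, h⟩ := hs
      rw [← h]
      simpa [entryBase] using hs
    | true =>
      refine ⟨{((src k, tgt k), P)}, ?_, (Multiset.prod_singleton _).symm, rfl⟩
      intro m hm
      obtain rfl := Multiset.mem_singleton.1 hm
      refine .branch hpath ?_ ⟨k, rfl, rfl, hs⟩ hprod
      -- Flattening does not lower the number of branches: a label in `SPPlus A` is nonempty, so it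
      -- has at least one factor.
      have hcard : M'.card ≤ (M'.bind E).card := by
        rw [Multiset.card_bind]
        have h := Multiset.card_nsmul_le_sum (s := M'.map (Multiset.card ∘ E)) (a := 1) (by
          intro c hc
          obtain ⟨x, hx, rfl⟩ := Multiset.mem_map.1 hc
          rw [Function.comp_apply, Nat.succ_le_iff, Multiset.card_pos]
          intro h₀
          refine x.2.2.2 ?_
          rw [hEP x hx, h₀]
          rfl)
        simpa using h
      omega

theorem mem_closure_cases {M : Type*} [AddCommMonoid M] {t : Set M} {s : M}
    (hs : s ∈ AddSubmonoid.closure t) :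
    s = 0 ∨ ∃ p ∈ t, ∃ s' ∈ AddSubmonoid.closure t, p + s' = s := by
  induction hs using AddSubmonoid.closure_induction_left with
  | zero => exact Or.inl rfl
  | add_left p hp s' hs' _ => exact Or.inr ⟨p, hp, s', hs', rfl⟩

/-- Every parallel product of paths between original states whose pairs of end states form the
multiset `s` labels a path through the loop of index `k`. -/
def LoopGenerates (seq : Set (Q × A × Q)) (src tgt : κ → Q) (base : κ → Multiset (Q × Q))
    (per : κ → Set (Multiset (Q × Q))) (k : κ) (s : Multiset (Q × Q)) : Prop :=
  ∀ (M : Multiset ((Q × Q) × SPPlus A)) (P : SPPlus A),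
    (∀ m ∈ M, BlockPath (loopSeq κ seq) (fun x w y => (x, w, y) ∈ loopBlocks src tgt base per)
      (Sum.inl m.1.1) m.2 (Sum.inl m.1.2)) →
    M.map Prod.fst = s → P.1 = (M.map fun m => m.2.1).prod →
    BlockPath (loopSeq κ seq) (fun x w y => (x, w, y) ∈ loopBlocks src tgt base per)
      (loopPair Q k).1 P (loopPair Q k).2

theorem map_fst_liftPairs (M : Multiset ((Q × Q) × SPPlus A)) :
    (M.map (Prod.map (Prod.map Sum.inl Sum.inl) id)).map Prod.fst =
      liftPairs κ (M.map Prod.fst) := by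
  rw [liftPairs, Multiset.map_map, Multiset.map_map]
  rfl

/-- One block is enough at each stage: `p` is taken directly, and `s` either directly, if it is zero
or one period, or as the label of a single loop branch. In the latter case `p ≠ 0` supplies the
second branch. -/
theorem blockPath_entry {seq : Set (Q × A × Q)} {k : κ} {z : Bool} {p s : Multiset (Q × Q)}
    (hp : p ∈ insert 0 (per k))
    (hs : s ∈ insert 0 (per k) ∨ p ≠ 0 ∧ LoopGenerates seq src tgt base per k s)
    {M : Multiset ((Q × Q) × SPPlus A)}
    (hM : ∀ m ∈ M, BlockPath (loopSeq κ seq)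
      (fun x w y => (x, w, y) ∈ loopBlocks src tgt base per) (Sum.inl m.1.1) m.2 (Sum.inl m.1.2))
    (hMs : M.map Prod.fst = entryBase base k z + p + s) (hcard : 1 < M.card) {P : SPPlus A}
    (hP : P.1 = (M.map fun m => m.2.1).prod) :
    BlockPath (loopSeq κ seq) (fun x w y => (x, w, y) ∈ loopBlocks src tgt base per)
      (entryPair src tgt k z).1 P (entryPair src tgt k z).2 := by
  by_cases hs' : s ∈ insert 0 (per k)
  · have hfst : (M.map (Prod.map (Prod.map Sum.inl Sum.inl) id)).map Prod.fst =
        liftPairs κ (entryBase base k z + p) + liftPairs κ s := by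
      rw [map_fst_liftPairs, hMs, liftPairs, Multiset.map_add]
      rfl
    refine .branch (M := M.map (Prod.map (Prod.map Sum.inl Sum.inl) id)) ?_ ?_
      ⟨?_, k, z, p, hp, liftPairs κ s, Or.inr ⟨s, hs', rfl⟩, ?_⟩ ?_
    · intro m hm
      obtain ⟨m, hm', rfl⟩ := Multiset.mem_map.1 hm
      exact hM m hm'
    · simpa using hcard
    · simpa using hcard
    · rw [hfst]
    · rw [hP, Multiset.map_map]
      rfl
  · obtain ⟨hp₀, hloop⟩ := hs.resolve_left hs'
    obtain ⟨M₁, M₂, rfl, h₁, h₂⟩ := Multiset.exists_add_of_map_eq _ hMs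
    -- The loop branch needs a nonempty label; `M₂` is nonempty since `s = 0` falls under the first
    -- case.
    obtain ⟨P₂, hP₂⟩ := SPPlus.exists_val_eq_prod (M₂.map Prod.snd) (by
      intro h
      refine hs' (Or.inl ?_)
      rw [← h₂, Multiset.map_eq_zero.1 h, Multiset.map_zero])
    rw [Multiset.map_map] at hP₂
    have hcard₁ : 0 < M₁.card := by
      rw [← Multiset.card_map Prod.fst M₁, h₁, Multiset.card_add]
      have := Multiset.card_pos.2 hp₀
      omega
    have hpath := hloop M₂ P₂ (fun m hm => hM m (Multiset.mem_add.2 (Or.inr hm))) h₂ hP₂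
    refine .branch (M := M₁.map (Prod.map (Prod.map Sum.inl Sum.inl) id) + {(loopPair Q k, P₂)})
      ?_ ?_ ⟨?_, k, z, p, hp, {loopPair Q k}, Or.inl rfl, ?_⟩ ?_
    · intro m hm
      rcases Multiset.mem_add.1 hm with hm | hm
      · obtain ⟨m, hm', rfl⟩ := Multiset.mem_map.1 hm
        exact hM m (Multiset.mem_add.2 (Or.inl hm'))
      · obtain rfl := Multiset.mem_singleton.1 hm
        exact hpath
    · simpa using hcard₁
    · simpa using hcard₁
    · rw [Multiset.map_add, map_fst_liftPairs, h₁]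
      rfl
    · rw [hP, Multiset.map_add, Multiset.map_add, Multiset.prod_add, Multiset.prod_add,
        Multiset.map_map, Multiset.map_singleton, Multiset.prod_singleton, hP₂]
      rfl

/-- Periods are split off one by one. A lone period may consist of a single branch, which is not a
legal block; this is why a remainder of at most one period is an alternative, absorbed by the
previous block. -/
theorem loopGenerates_of_mem_closure {seq : Set (Q × A × Q)} {k : κ} (hper : 0 ∉ per k)
    {s : Multiset (Q × Q)} (hs : s ∈ AddSubmonoid.closure (per k)) :
    s ∈ insert 0 (per k) ∨ LoopGenerates seq src tgt base per k s := by
  induction hs using AddSubmonoid.closure_induction_left with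
  | zero => exact Or.inl (Or.inl rfl)
  | add_left p hp s _ ih =>
    by_cases hs₀ : s = 0
    · subst hs₀
      exact Or.inl (Or.inr (by simpa using hp))
    · have hp₀ : p ≠ 0 := fun h => hper (h ▸ hp)
      refine Or.inr fun M P hM hMs hP => ?_
      refine blockPath_entry (z := false) (Or.inr hp) (ih.imp_right fun h => ⟨hp₀, h⟩) hM
        (by rw [hMs, entryBase, zero_add]) ?_ hP
      rw [← Multiset.card_map Prod.fst M, hMs, Multiset.card_add]
      have h₁ := Multiset.card_pos.2 hp₀
      have h₂ := Multiset.card_pos.2 hs₀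
      omega

/-- Between original states `Expands` leaves a single pair, so the flattened product is one path.
Conversely, each linear block is entered with its base and at most one period, and the loop supplies
the rest. -/
theorem blockPath_loop_iff {seq : Set (Q × A × Q)} (hper : ∀ k, 0 ∉ per k) {p q : Q}
    {P : SPPlus A} :
    BlockPath (loopSeq κ seq) (fun x w y => (x, w, y) ∈ loopBlocks src tgt base per)
      (Sum.inl p) P (Sum.inl q) ↔ BlockPath seq (LinearBlock src tgt base per) p P q := by
  constructor
  · intro h
    obtain ⟨M, hM, hP, hE⟩ := blockPath_of_loop h
    obtain ⟨m, rfl, hm⟩ := Multiset.map_eq_singleton.1 hE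
    have hb := hM m (Multiset.mem_singleton_self m)
    rw [hm] at hb
    rw [Multiset.map_singleton, Multiset.prod_singleton] at hP
    obtain rfl := Subtype.ext hP
    exact hb
  · intro h
    induction h with
    | letter h => exact .letter ⟨_, h, rfl⟩
    | comp _ _ ih ih' => exact .comp ih ih'
    | branch _ hcard hB hP ih =>
      obtain ⟨k, rfl, rfl, s, hs, hw⟩ := hB
      rcases mem_closure_cases hs with rfl | ⟨u, hu, s', hs', rfl⟩
      · exact blockPath_entry (k := k) (z := true) (p := 0) (s := 0) (Or.inl rfl)
          (Or.inl (Or.inl rfl)) ih (by rw [← hw, entryBase, add_zero, add_zero]) hcard hP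
      · exact blockPath_entry (k := k) (z := true) (Or.inr hu)
          ((loopGenerates_of_mem_closure (hper k) hs').imp_right
            fun h => ⟨fun h => hper k (h ▸ hu), h⟩)
          ih (by rw [← hw, add_assoc, entryBase]) hcard hP

theorem isRegularLanguage_of_linearBlock [Finite A] [Finite Q] [Finite κ]
    (seq : Set (Q × A × Q)) (hfin : ∀ k, (per k).Finite) (hper : ∀ k, 0 ∉ per k) (I F : Set Q) :
    IsRegularLanguage {P | ∃ p ∈ I, ∃ q ∈ F,
      BlockPath seq (LinearBlock src tgt base per) p P q} := by
  convert isRegularLanguage_of_finite_blocks (loopSeq κ seq)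
    (finite_loopBlocks src tgt base hfin) (fun t ht => ht.1) (Sum.inl '' I) (Sum.inl '' F) using 1
  ext P
  simp [blockPath_loop_iff hper]

end Linear

/-! ### Semilinear sets of blocks and Presburger formulas -/

section Semilinear

/-- Zero periods are discarded without changing the sums; the loops need periods that contribute a
branch. -/
theorem IsSemilinearSet.exists_fintype_index {M : Type} [AddCommMonoid M] {s : Set M}
    (hs : IsSemilinearSet s) :
    ∃ (κ : Type) (_ : Finite κ) (b : κ → M) (t : κ → Set M),
      (∀ k, (t k).Finite) ∧ (∀ k, 0 ∉ t k) ∧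
        ∀ w, w ∈ s ↔ ∃ k, ∃ u ∈ AddSubmonoid.closure (t k), b k + u = w := by
  obtain ⟨S, hS, hlin, rfl⟩ := hs
  have := hS.to_subtype
  choose b t ht hbt using fun k : S => hlin k.1 k.2
  refine ⟨S, this, b, fun k => t k \ {0}, fun k => (ht k).sdiff, fun k h => h.2 rfl, fun w => ?_⟩
  have hcl : ∀ k, AddSubmonoid.closure (t k \ {0}) = AddSubmonoid.closure (t k) := by
    intro k
    refine le_antisymm (AddSubmonoid.closure_mono Set.sdiff_subset)
      (AddSubmonoid.closure_le.2 fun x hx => ?_)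
    by_cases h : x = 0
    · rw [h]
      exact zero_mem _
    · exact AddSubmonoid.subset_closure ⟨hx, h⟩
  simp only [hcl, Set.mem_sUnion]
  constructor
  · rintro ⟨k, hk, hw⟩
    exact ⟨⟨k, hk⟩, (Set.ext_iff.1 (hbt ⟨k, hk⟩) w).1 hw⟩
  · rintro ⟨k, u, hu, rfl⟩
    refine ⟨k.1, k.2, ?_⟩
    rw [hbt k]
    exact ⟨u, hu, rfl⟩

theorem exists_linearBlock_eq {Q : Type} [Finite Q] {B : Q → Multiset (Q × Q) → Q → Prop}
    (hB : ∀ p q, IsSemilinearSet {w | B p w q}) :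
    ∃ (κ : Type) (_ : Finite κ) (src tgt : κ → Q) (base : κ → Multiset (Q × Q))
      (per : κ → Set (Multiset (Q × Q))),
      (∀ k, (per k).Finite) ∧ (∀ k, 0 ∉ per k) ∧ B = LinearBlock src tgt base per := by
  choose κ hκ b t hfin hper hmem using fun t : Q × Q => (hB t.1 t.2).exists_fintype_index
  refine ⟨Σ t, κ t, inferInstance, fun k => k.1.1, fun k => k.1.2, fun k => b k.1 k.2,
    fun k => t k.1 k.2, fun k => hfin k.1 k.2, fun k => hper k.1 k.2, ?_⟩
  ext p w q
  refine (hmem (p, q) w).trans ⟨?_, ?_⟩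
  · rintro ⟨k, h⟩
    exact ⟨⟨(p, q), k⟩, rfl, rfl, h⟩
  · rintro ⟨⟨⟨p', q'⟩, k⟩, hp, hq, h⟩
    dsimp only at hp hq
    subst hp hq
    exact ⟨k, h⟩

theorem isRegularLanguage_of_isSemilinearSet {A : Type u} {Q : Type} [Finite A] [Finite Q]
    (seq : Set (Q × A × Q)) {B : Q → Multiset (Q × Q) → Q → Prop}
    (hB : ∀ p q, IsSemilinearSet {w | B p w q}) (I F : Set Q) :
    IsRegularLanguage {P | ∃ p ∈ I, ∃ q ∈ F, BlockPath seq B p P q} := by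
  obtain ⟨κ, _, src, tgt, base, per, hfin, hper, rfl⟩ := exists_linearBlock_eq hB
  exact isRegularLanguage_of_linearBlock seq hfin hper I F

/-- The Ginsburg–Spanier theorem: Presburger definable sets are the semilinear ones. -/
theorem isSemilinearSet_presburgerSet {Q : Type} [Finite Q] (φ : Pres Q) :
    IsSemilinearSet (presburgerSet φ) :=
  FirstOrder.Language.presburger.definable_iff_isSemilinearSet.1
    (Set.empty_definable_iff.2 ⟨φ, rfl⟩ : (∅ : Set ℕ).Definable _ _)

theorem exists_presburgerSet_eq_singleton {Q : Type} [Finite Q] (v : Q → ℕ) :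
    ∃ φ : Pres Q, presburgerSet φ = {v} := by
  obtain ⟨φ, hφ⟩ := Set.empty_definable_iff.1
    (FirstOrder.Language.presburger.definable_iff_isSemilinearSet.2
      (IsSemilinearSet.singleton v) : (∅ : Set ℕ).Definable _ _)
  exact ⟨φ, hφ.symm⟩

theorem parikh_injective {Q : Type} : Function.Injective (parikh (Q := Q)) := by
  classical
  intro R S h
  ext q
  have := congrFun h q
  unfold parikh at this
  convert this

theorem parikh_add {Q : Type} (R S : Multiset Q) : parikh (R + S) = parikh R + parikh S := by
  classical exact funext fun q => Multiset.count_add q R S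

theorem parikh_zero {Q : Type} : parikh (0 : Multiset Q) = 0 := by
  classical exact funext fun q => Multiset.count_zero q

theorem Multiset.addMonoid_fg {α : Type*} [Finite α] : AddMonoid.FG (Multiset α) := by
  refine ⟨(AddSubmonoid.fg_iff _).2 ⟨Set.range fun a : α => {a}, ?_, Set.finite_range _⟩⟩
  refine eq_top_iff.2 fun M _ => ?_
  induction M using Multiset.induction with
  | empty => exact zero_mem _
  | cons a M ih =>
    rw [← Multiset.singleton_add]
    exact add_mem (AddSubmonoid.subset_closure ⟨a, rfl⟩) (ih trivial)

/-- The map `w ↦ parikh (w.map f)` is additive on a finitely generated monoid, and preimages of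
semilinear sets under such maps are semilinear. -/
theorem isSemilinearSet_parikh_map {Q R : Type} [Finite Q] [Finite R] (f : R → Q) (φ : Pres Q) :
    IsSemilinearSet {w : Multiset R | parikh (w.map f) ∈ presburgerSet φ} := by
  have := Multiset.addMonoid_fg (α := R)
  exact (isSemilinearSet_presburgerSet φ).preimage
    ({ toFun := fun w => parikh (w.map f)
       map_zero' := parikh_zero
       map_add' := fun w w' => by rw [Multiset.map_add, parikh_add] } : Multiset R →+ (Q → ℕ))

theorem isSemilinearSet_exists_parikh_map {Q R : Type} [Finite Q] [Finite R] (f : R → Q)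
    {T : Set (Q × Pres Q)} (hT : T.Finite) (p : Q) :
    IsSemilinearSet {w : Multiset R | ∃ t ∈ T, t.1 = p ∧ parikh (w.map f) ∈ presburgerSet t.2} := by
  convert IsSemilinearSet.biUnion (hT.inter_of_left {t | t.1 = p})
    fun t _ => isSemilinearSet_parikh_map f t.2 using 1
  ext w
  simp [and_assoc]

end Semilinear

/-! ### The two inclusions between classes of languages -/

section Languages

variable {A : Type u} {L : Set (SPPlus A)}

theorem IsRegularLanguage.isPRegularLanguage (h : IsRegularLanguage L) : IsPRegularLanguage L := by
  obtain ⟨Q, _, 𝒜, rfl⟩ := h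
  choose φ hφ using fun R : Multiset Q => exists_presburgerSet_eq_singleton (parikh R)
  have hmem : ∀ R S, parikh R ∈ presburgerSet (φ S) ↔ S = R := by
    intro R S
    rw [hφ, Set.mem_singleton_iff, parikh_injective.eq_iff, eq_comm]
  refine ⟨Q, inferInstance,
    { seq := 𝒜.seq
      fork := (fun t => (t.1, φ t.2.1)) '' 𝒜.fork
      join := (fun t => (t.2, φ t.1.1)) '' 𝒜.join
      init := 𝒜.init
      final := 𝒜.final
      seq_finite := 𝒜.seq_finite
      fork_finite := 𝒜.fork_finite.image _
      join_finite := 𝒜.join_finite.image _ }, ?_⟩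
  ext P
  simp only [BranchingAutomaton.language, PBranchingAutomaton.language,
    BranchingAutomaton.HasPath, PBranchingAutomaton.HasPath, Set.exists_mem_image, hmem,
    Set.mem_ofPred_eq, and_comm]

theorem IsPRegularLanguage.isRegularLanguage [Finite A] (h : IsPRegularLanguage L) :
    IsRegularLanguage L := by
  obtain ⟨Q, _, 𝒜, rfl⟩ := h
  simp only [PBranchingAutomaton.language, PBranchingAutomaton.HasPath, hasPath_iff_blockPath]
  refine isRegularLanguage_of_isSemilinearSet 𝒜.seq (fun p q => ?_) 𝒜.init 𝒜.final
  -- The fork constrains the starts and the join the ends; semilinear sets are closed under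
  -- intersection.
  exact (isSemilinearSet_exists_parikh_map Prod.fst 𝒜.fork_finite p).inter
    (isSemilinearSet_exists_parikh_map Prod.snd 𝒜.join_finite q)

end Languages

theorem mainTheorem4 {A : Type u} [Finite A] [Nonempty A] (L : Set (SPPlus A)) :
    IsRegularLanguage L ↔ IsPRegularLanguage L :=
  ⟨IsRegularLanguage.isPRegularLanguage, IsPRegularLanguage.isRegularLanguage⟩
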